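/- A \emph{lattice equable parallelogram} (LEP) is a nondegenerate parallelogram in the Euclidean plane $\mathbb{R}^2$ whose vertices lie in $\mathbb{Z}^2$ and whose perimeter equals its area. The \emph{first quadrant} is the closed set $\{(x,y)\in\mathbb{R}^2 : x\ge 0,\ y\ge 0\}$. (i) Let $P$ be a LEP with vertices $O,A,B,C$ in cyclic order, where $O=(0,0)$ is the origin. Suppose that $OB$ is a long diagonal of $P$, that is, $|OB|\ge |AC|$, and that the segment $OB$ is contained in the first quadrant. Then all four vertices $O,A,B,C$ lie in the first quadrant. (ii) For every LEP $P$ there is a Euclidean motion (isometry) $g$ of $\mathbb{R}^2$ such that $g(P)$ is again a LEP, is contained in the first quadrant, and has a vertex at the origin. -/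

import Mathlib

open MeasureTheory

noncomputable section

/-- The Euclidean plane. -/
abbrev Plane : Type := EuclideanSpace ℝ (Fin 2)

/-- The filled quadrilateral region spanned by four points. -/
def region (P : Fin 4 → Plane) : Set Plane :=
  convexHull ℝ (Set.range P)

/-- The perimeter of the quadrilateral with vertices `P 0, P 1, P 2, P 3` in cyclic order. -/
def perimeter (P : Fin 4 → Plane) : ℝ :=
  dist (P 0) (P 1) + dist (P 1) (P 2) + dist (P 2) (P 3) + dist (P 3) (P 0)

/-- The area (two-dimensional Lebesgue measure) of the quadrilateral region. -/
def area (P : Fin 4 → Plane) : ℝ :=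
  volume.real (region P)

/-- `P 0, P 1, P 2, P 3` are, in cyclic order (of either orientation), the vertices of a
nondegenerate parallelogram. -/
def IsParallelogram (P : Fin 4 → Plane) : Prop :=
  AffineIndependent ℝ ![P 0, P 1, P 2] ∧ P 1 - P 0 = P 2 - P 3

/-- The point has integer coordinates. -/
def IsLatticePoint (p : Plane) : Prop :=
  ∀ j, ∃ n : ℤ, p j = n

/-- Lattice equable parallelogram, given by its vertices in cyclic order. -/
structure IsLEP (P : Fin 4 → Plane) : Prop where
  parallelogram : IsParallelogram P
  lattice : ∀ i, IsLatticePoint (P i)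
  equable : perimeter P = area P

/-- The closed first quadrant. -/
def firstQuadrant : Set Plane :=
  {p | 0 ≤ p 0 ∧ 0 ≤ p 1}

end

/-! Let `u`, `v` be the edges at an end of a long diagonal, so `u · v ≥ 0`, with `u + v` in the
first quadrant. If one edge leaves the quadrant, the dot product forces, up to symmetry, `u = (-a,
b)`, `v = (c, d)` with `a, b, c, d > 0`, and equability reads `2(|u| + |v|) = ad + bc`. Both lengths
are then integers, and a Pythagorean hypotenuse is at most the sum of its legs minus 2, which makes
the perimeter too small (`not_equable_of_adjacent_quadrants`). For (ii), translation and axis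
reflections reduce to (i). -/

/-! ### Arithmetic of the edge vectors -/

/-- The legs of an integral right triangle exceed its hypotenuse by at least two, and both are
at least three. -/
lemma pythagorean_leg_bounds {a b m : ℤ} (ha : 0 < a) (hb : 0 < b) (hm : 0 ≤ m)
    (h : a ^ 2 + b ^ 2 = m ^ 2) : m + 2 ≤ a + b ∧ 3 ≤ a ∧ 3 ≤ b := by
  have hlt : m < a + b := by nlinarith [mul_pos ha hb]
  have hpar : Even (a + b + m) := by
    have h2 : Even (a ^ 2 + b ^ 2 + m ^ 2) := ⟨m ^ 2, by rw [h]⟩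
    simpa [Int.even_add, Int.even_pow] using h2
  obtain ⟨k, hk⟩ := hpar
  have hle : m + 2 ≤ a + b := by omega
  -- Square `m ≤ a + b - 2` and substitute `m ^ 2 = a ^ 2 + b ^ 2`.
  have hprod : 2 ≤ (a - 2) * (b - 2) := by nlinarith
  refine ⟨hle, ?_, ?_⟩
  · by_contra! hlt3
    interval_cases a <;> nlinarith
  · by_contra! hlt3
    interval_cases b <;> nlinarith

/-- If `√p + √q` is a positive rational number then `√p` is an integer. -/
lemma exists_int_sqrt_eq_of_sqrt_add_sqrt {p q N : ℤ} (hp : 0 ≤ p) (hq : 0 ≤ q) (hN : 0 < N)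
    (h : 2 * (√(p : ℝ) + √(q : ℝ)) = N) : ∃ m : ℤ, 0 ≤ m ∧ √(p : ℝ) = m ∧ p = m ^ 2 := by
  have hp' : (0 : ℝ) ≤ p := by exact_mod_cast hp
  have hq' : (0 : ℝ) ≤ q := by exact_mod_cast hq
  have hN' : (0 : ℝ) < N := by exact_mod_cast hN
  -- Squaring `√q = N / 2 - √p` leaves an equation linear in `√p`.
  have hrat : √(p : ℝ) = ((((N : ℚ) ^ 2 + 4 * p - 4 * q) / (4 * N) : ℚ) : ℝ) := by
    push_cast
    rw [eq_div_iff (by positivity)]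
    have hsq : √(q : ℝ) = N / 2 - √(p : ℝ) := by linarith
    have h3 := Real.sq_sqrt hq'
    rw [hsq] at h3
    nlinarith [Real.sq_sqrt hp']
  have hirr : ¬ Irrational (√(p : ℝ)) := fun hi => hi ⟨_, hrat.symm⟩
  rw [irrational_sqrt_intCast_iff_of_nonneg hp, not_not] at hirr
  obtain ⟨r, rfl⟩ := hirr
  refine ⟨|r|, abs_nonneg r, ?_, by rw [sq_abs, sq]⟩
  push_cast
  exact Real.sqrt_mul_self_eq_abs _

/-- No equable lattice parallelogram has one side pointing strictly into the second quadrant and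
an adjacent one pointing strictly into the first. -/
lemma not_equable_of_adjacent_quadrants {a b c d : ℤ} (ha : 0 < a) (hb : 0 < b) (hc : 0 < c)
    (hd : 0 < d)
    (h : 2 * (√((a ^ 2 + b ^ 2 : ℤ) : ℝ) + √((c ^ 2 + d ^ 2 : ℤ) : ℝ)) = (a * d + b * c : ℤ)) :
    False := by
  have hN : 0 < a * d + b * c := by positivity
  obtain ⟨m, hm0, hm, hma⟩ :=
    exists_int_sqrt_eq_of_sqrt_add_sqrt (by positivity) (by positivity) hN h
  obtain ⟨n, hn0, hn, hnc⟩ :=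
    exists_int_sqrt_eq_of_sqrt_add_sqrt (by positivity) (by positivity) hN
      ((congrArg (2 * ·) (add_comm _ _)).trans h)
  rw [hm, hn] at h
  have h' : 2 * (m + n) = a * d + b * c := by exact_mod_cast h
  obtain ⟨h1, ha3, hb3⟩ := pythagorean_leg_bounds ha hb hm0 hma
  obtain ⟨h2, hc3, hd3⟩ := pythagorean_leg_bounds hc hd hn0 hnc
  -- `ad + bc = (a-2)(d-2) + (b-2)(c-2) + 2(a+b+c+d) - 8`, while `2(m + n) ≤ 2(a+b+c+d) - 8`.
  nlinarith [mul_pos (show 0 < a - 2 by omega) (show 0 < d - 2 by omega),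
    mul_pos (show 0 < b - 2 by omega) (show 0 < c - 2 by omega)]

/-- If `a < 0` then `c > 0`, so `bd ≥ -ac > 0`; as `b + d ≥ 0`, both are positive, the excluded
configuration. Swapping axes or edges covers the other coordinates. -/
lemma nonneg_of_equable_of_dot_nonneg {a b c d : ℤ}
    (h : 2 * (√((a ^ 2 + b ^ 2 : ℤ) : ℝ) + √((c ^ 2 + d ^ 2 : ℤ) : ℝ)) = (|a * d - b * c| : ℤ))
    (hdot : 0 ≤ a * c + b * d) (hac : 0 ≤ a + c) (hbd : 0 ≤ b + d) : 0 ≤ a := by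
  by_contra! ha
  have hc : 0 < c := by omega
  have hpos : 0 < b * d := by nlinarith
  have hd : 0 < d := by
    by_contra! hd
    have hb : b < 0 := by
      by_contra! hb
      nlinarith
    omega
  have hb : 0 < b := pos_of_mul_pos_left hpos hd.le
  refine not_equable_of_adjacent_quadrants (a := -a) (by omega) hb hc hd ?_
  have habs : |a * d - b * c| = -a * d + b * c := by
    rw [abs_of_neg (by nlinarith [mul_pos hb hc])]
    ring
  rw [neg_sq, h, habs]

/-- Two integral edge vectors of an equable parallelogram, with non-obtuse angle between them and
with sum in the first quadrant, lie in the first quadrant. -/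
lemma mem_firstQuadrant_of_equable {u v : Plane} (hu : IsLatticePoint u) (hv : IsLatticePoint v)
    (h : 2 * (‖u‖ + ‖v‖) = |u 0 * v 1 - u 1 * v 0|) (hdot : 0 ≤ u 0 * v 0 + u 1 * v 1)
    (hsum : u + v ∈ firstQuadrant) : u ∈ firstQuadrant ∧ v ∈ firstQuadrant := by
  obtain ⟨a, ha⟩ := hu 0
  obtain ⟨b, hb⟩ := hu 1
  obtain ⟨c, hc⟩ := hv 0
  obtain ⟨d, hd⟩ := hv 1
  simp only [firstQuadrant, Set.mem_ofPred_eq, PiLp.add_apply] at hsum ⊢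
  simp only [EuclideanSpace.norm_eq, Fin.sum_univ_two, Real.norm_eq_abs, sq_abs] at h
  rw [ha, hb, hc, hd] at h hdot hsum ⊢
  replace hdot : 0 ≤ a * c + b * d := by
    rw [← Int.cast_nonneg_iff (R := ℝ)]
    push_cast
    exact hdot
  norm_cast at hsum ⊢
  obtain ⟨hac, hbd⟩ := hsum
  have h' : 2 * (√((a ^ 2 + b ^ 2 : ℤ) : ℝ) + √((c ^ 2 + d ^ 2 : ℤ) : ℝ)) =
      (|a * d - b * c| : ℤ) := by
    push_cast
    exact h
  refine ⟨⟨nonneg_of_equable_of_dot_nonneg h' hdot hac hbd,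
      nonneg_of_equable_of_dot_nonneg (a := b) (b := a) (c := d) (d := c) ?_
        (by linarith) hbd hac⟩,
    nonneg_of_equable_of_dot_nonneg (a := c) (b := d) (c := a) (d := b) ?_
        (by linarith) (by linarith) (by linarith),
    nonneg_of_equable_of_dot_nonneg (a := d) (b := c) (c := b) (d := a) ?_
        (by linarith) (by linarith) (by linarith)⟩
  · rw [abs_sub_comm, add_comm (b ^ 2), add_comm (d ^ 2)]
    convert h' using 3
  · rw [abs_sub_comm, add_comm √_, mul_comm d, mul_comm c, h']
  · rw [add_comm √_, add_comm (b ^ 2), add_comm (d ^ 2)]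
    convert h' using 3
    ring_nf

/-! ### Area and perimeter from edge vectors -/

open scoped Pointwise in
/-- A parallelogram region is a translate of the parallelepiped on its edge vectors. -/
lemma region_eq_vadd_parallelepiped {P : Fin 4 → Plane} (h : P 1 - P 0 = P 2 - P 3) :
    region P = P 0 +ᵥ parallelepiped ![P 1 - P 0, P 3 - P 0] := by
  rw [region, parallelepiped_eq_convexHull, ← convexHull_vadd]
  congr 1
  have h2 : P 2 = P 0 + (P 1 - P 0 + (P 3 - P 0)) := by
    rw [h]
    abel
  have hsum : ∑ i, {(0 : Plane), ![P 1 - P 0, P 3 - P 0] i} =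
      ({0, P 3 - P 0, P 1 - P 0, P 1 - P 0 + (P 3 - P 0)} : Set Plane) := by
    rw [Fin.sum_univ_two, Set.insert_eq 0 {![P 1 - P 0, P 3 - P 0] 0}, Set.union_add]
    simp only [Matrix.cons_val_zero, Matrix.cons_val_one, Set.singleton_add, Set.image_pair,
      zero_add, add_zero, Set.insert_union, Set.singleton_union]
  rw [hsum]
  simp only [Set.vadd_set_insert, Set.vadd_set_singleton, vadd_eq_add, ← h2, add_zero,
    add_sub_cancel]
  ext x
  simp only [Set.mem_range, Set.mem_insert_iff, Set.mem_singleton_iff]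
  constructor
  · rintro ⟨i, rfl⟩
    fin_cases i <;> simp
  · rintro (rfl | rfl | rfl | rfl) <;> exact ⟨_, rfl⟩

/-- The area of a parallelogram is the absolute value of the determinant of its edges. -/
lemma area_eq_abs_det {P : Fin 4 → Plane} (h : P 1 - P 0 = P 2 - P 3) :
    area P = |(P 1 - P 0) 0 * (P 3 - P 0) 1 - (P 1 - P 0) 1 * (P 3 - P 0) 0| := by
  rw [area, region_eq_vadd_parallelepiped h, measureReal_def, measure_vadd,
    ← (EuclideanSpace.basisFun (Fin 2) ℝ).addHaar_eq_volume, Measure.addHaar_parallelepiped,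
    ENNReal.toReal_ofReal (abs_nonneg _), Module.Basis.det_apply, Matrix.det_fin_two]
  simp only [Module.Basis.toMatrix_apply, Matrix.cons_val_zero, Matrix.cons_val_one,
    OrthonormalBasis.coe_toBasis_repr_apply, EuclideanSpace.basisFun_repr]
  rw [mul_comm ((P 3 - P 0) 0)]

lemma perimeter_eq {P : Fin 4 → Plane} (h : P 1 - P 0 = P 2 - P 3) :
    perimeter P = 2 * (‖P 1 - P 0‖ + ‖P 3 - P 0‖) := by
  have h2 : P 1 - P 2 = P 0 - P 3 := by
    rw [sub_eq_sub_iff_add_eq_add] at h ⊢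
    rw [h, add_comm]
  rw [perimeter, dist_comm (P 0), dist_eq_norm, dist_eq_norm, dist_eq_norm, dist_eq_norm, h2, ← h,
    norm_sub_rev (P 0)]
  ring

lemma IsLatticePoint.sub {p q : Plane} (hp : IsLatticePoint p) (hq : IsLatticePoint q) :
    IsLatticePoint (p - q) := fun j => by
  obtain ⟨m, hm⟩ := hp j
  obtain ⟨n, hn⟩ := hq j
  exact ⟨m - n, by simp [hm, hn]⟩

/-- The edge vectors of a lattice equable parallelogram at a vertex. -/
lemma IsLEP.edge_equation {P : Fin 4 → Plane} (hP : IsLEP P) :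
    2 * (‖P 1 - P 0‖ + ‖P 3 - P 0‖) =
      |(P 1 - P 0) 0 * (P 3 - P 0) 1 - (P 1 - P 0) 1 * (P 3 - P 0) 0| := by
  rw [← perimeter_eq hP.parallelogram.2, ← area_eq_abs_det hP.parallelogram.2, hP.equable]

/-- The diagonal `u + v` is at least as long as the diagonal `u - v` when the angle between `u` and
`v` is not obtuse. -/
lemma dot_nonneg_of_norm_sub_le {u v : Plane} (h : ‖u - v‖ ≤ ‖u + v‖) :
    0 ≤ u 0 * v 0 + u 1 * v 1 := by
  have h2 := pow_le_pow_left₀ (norm_nonneg _) h 2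
  simp only [EuclideanSpace.norm_sq_eq, Fin.sum_univ_two, Real.norm_eq_abs, sq_abs,
    PiLp.add_apply, PiLp.sub_apply] at h2
  linarith

/-! ### Reflections and lattice-preserving motions -/

/-- Reflection in the coordinate axes taking a given point into the first quadrant. -/
noncomputable def signFlip (w : Plane) : Plane ≃ₗᵢ[ℝ] Plane :=
  LinearIsometryEquiv.piLpCongrRight 2
    fun j => if 0 ≤ w j then LinearIsometryEquiv.refl ℝ ℝ else LinearIsometryEquiv.neg ℝ

lemma signFlip_apply (w x : Plane) (j : Fin 2) :
    signFlip w x j = if 0 ≤ w j then x j else -x j := by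
  simp only [signFlip, LinearIsometryEquiv.piLpCongrRight_apply, PiLp.toLp_apply]
  split_ifs <;> simp

lemma signFlip_self_mem (w : Plane) : signFlip w w ∈ firstQuadrant := by
  constructor <;> rw [signFlip_apply] <;> split_ifs <;> linarith

lemma IsLatticePoint.signFlip {x : Plane} (hx : IsLatticePoint x) (w : Plane) :
    IsLatticePoint (signFlip w x) := fun j => by
  obtain ⟨n, hn⟩ := hx j
  rw [signFlip_apply]
  split_ifs
  · exact ⟨n, hn⟩
  · exact ⟨-n, by simp [hn]⟩

lemma abs_det_signFlip (w u v : Plane) :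
    |signFlip w u 0 * signFlip w v 1 - signFlip w u 1 * signFlip w v 0| =
      |u 0 * v 1 - u 1 * v 0| := by
  simp only [signFlip_apply]
  split_ifs
  · rfl
  · rw [← abs_neg]
    ring_nf
  · rw [← abs_neg]
    ring_nf
  · ring_nf

/-- Translation of `t` to the origin followed by `signFlip w`. -/
noncomputable def flipMotion (w t : Plane) : Plane ≃ᵃⁱ[ℝ] Plane :=
  (AffineIsometryEquiv.constVAdd ℝ Plane (-t)).trans (signFlip w).toAffineIsometryEquiv

lemma flipMotion_apply (w t p : Plane) : flipMotion w t p = signFlip w (p - t) := by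
  simp [flipMotion, sub_eq_neg_add]

lemma IsLEP.flipMotion {P : Fin 4 → Plane} (hP : IsLEP P) (w : Plane) {t : Plane}
    (ht : IsLatticePoint t) : IsLEP fun i => flipMotion w t (P i) := by
  have hsub : ∀ p q, _root_.flipMotion w t p - _root_.flipMotion w t q = signFlip w (p - q) := by
    intro p q
    rw [flipMotion_apply, flipMotion_apply, ← map_sub, sub_sub_sub_cancel_right]
  have hpar : _root_.flipMotion w t (P 1) - _root_.flipMotion w t (P 0) =
      _root_.flipMotion w t (P 2) - _root_.flipMotion w t (P 3) := by
    rw [hsub, hsub, hP.parallelogram.2]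
  refine ⟨⟨?_, hpar⟩, fun i => ?_, ?_⟩
  · have := (_root_.flipMotion w t).toAffineEquiv.affineIndependent_iff.2 hP.parallelogram.1
    have hcomp : ![_root_.flipMotion w t (P 0), _root_.flipMotion w t (P 1),
        _root_.flipMotion w t (P 2)] = _root_.flipMotion w t ∘ ![P 0, P 1, P 2] := by
      funext i
      fin_cases i <;> rfl
    rw [hcomp]
    exact this
  · rw [flipMotion_apply]
    exact ((hP.lattice i).sub ht).signFlip w
  · rw [perimeter_eq hpar, area_eq_abs_det hpar]
    dsimp only
    rw [hsub, hsub, abs_det_signFlip, LinearIsometryEquiv.norm_map, LinearIsometryEquiv.norm_map,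
      hP.edge_equation]

lemma convex_firstQuadrant : Convex ℝ firstQuadrant := by
  rintro x ⟨hx0, hx1⟩ y ⟨hy0, hy1⟩ a b ha hb -
  constructor <;> simp only [PiLp.add_apply, PiLp.smul_apply, smul_eq_mul] <;> positivity

/-- Axis reflections preserve the lattice, lengths and unsigned area, so the diagonal `u + v` may be
assumed to lie in the first quadrant. -/
lemma signFlip_mem_of_equable {u v : Plane} (hu : IsLatticePoint u) (hv : IsLatticePoint v)
    (h : 2 * (‖u‖ + ‖v‖) = |u 0 * v 1 - u 1 * v 0|) (hle : ‖u - v‖ ≤ ‖u + v‖) :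
    signFlip (u + v) u ∈ firstQuadrant ∧ signFlip (u + v) v ∈ firstQuadrant := by
  refine mem_firstQuadrant_of_equable (hu.signFlip _) (hv.signFlip _) ?_ ?_ ?_
  · rw [abs_det_signFlip, LinearIsometryEquiv.norm_map, LinearIsometryEquiv.norm_map, h]
  · apply dot_nonneg_of_norm_sub_le
    rwa [← map_sub, ← map_add, LinearIsometryEquiv.norm_map, LinearIsometryEquiv.norm_map]
  · rw [← map_add]
    exact signFlip_self_mem _

theorem mainTheorem11 :
    (∀ P : Fin 4 → Plane, IsLEP P → P 0 = 0 →
      dist (P 1) (P 3) ≤ dist (P 0) (P 2) →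
      segment ℝ (P 0) (P 2) ⊆ firstQuadrant →
      ∀ i, P i ∈ firstQuadrant) ∧
    (∀ P : Fin 4 → Plane, IsLEP P →
      ∃ g : Plane ≃ᵃⁱ[ℝ] Plane,
        IsLEP (fun i => g (P i)) ∧
        region (fun i => g (P i)) ⊆ firstQuadrant ∧
        ∃ i, g (P i) = 0) := by
  constructor
  · intro P hP h0 hle hseg
    have hpar := hP.parallelogram.2
    have heq := hP.edge_equation
    rw [h0, sub_zero] at hpar
    rw [h0, sub_zero, sub_zero] at heq
    have h2 : P 1 + P 3 = P 2 := by rw [hpar, sub_add_cancel]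
    rw [h0, dist_zero_left, dist_eq_norm, ← h2] at hle
    have hmem2 : P 2 ∈ firstQuadrant := hseg (right_mem_segment ℝ _ _)
    obtain ⟨h1, h3⟩ := mem_firstQuadrant_of_equable (hP.lattice 1) (hP.lattice 3) heq
      (dot_nonneg_of_norm_sub_le hle) (h2 ▸ hmem2)
    intro i
    fin_cases i
    · exact hseg (left_mem_segment ℝ _ _)
    · exact h1
    · exact hmem2
    · exact h3
  · intro P hP
    have hpar := hP.parallelogram.2
    -- `P k` will be an end of a long diagonal and `w` the vector along that diagonal.
    suffices ∃ (w : Plane) (k : Fin 4), ∀ i, signFlip w (P i - P k) ∈ firstQuadrant by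
      obtain ⟨w, k, hk⟩ := this
      refine ⟨flipMotion w (P k), hP.flipMotion w (hP.lattice k), ?_, k, ?_⟩
      · refine convexHull_min ?_ convex_firstQuadrant
        rintro _ ⟨i, rfl⟩
        dsimp only
        rw [flipMotion_apply]
        exact hk i
      · rw [flipMotion_apply, sub_self, map_zero]
    rcases le_total (dist (P 1) (P 3)) (dist (P 0) (P 2)) with hle | hle
    · have hsum : P 1 - P 0 + (P 3 - P 0) = P 2 - P 0 := by
        rw [hpar]
        abel
      obtain ⟨h1, h3⟩ := signFlip_mem_of_equable ((hP.lattice 1).sub (hP.lattice 0))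
        ((hP.lattice 3).sub (hP.lattice 0)) hP.edge_equation (by
          rw [hsum, sub_sub_sub_cancel_right, ← dist_eq_norm, ← dist_eq_norm, dist_comm (P 2)]
          exact hle)
      rw [hsum] at h1 h3
      refine ⟨P 2 - P 0, 0, fun i => ?_⟩
      fin_cases i
      · simp [firstQuadrant]
      · exact h1
      · exact signFlip_self_mem _
      · exact h3
    · have h21 : P 2 - P 1 = P 3 - P 0 := by
        rw [sub_eq_sub_iff_add_eq_add] at hpar ⊢
        rw [add_comm (P 3), hpar]
      have hsum : P 2 - P 1 + (P 0 - P 1) = P 3 - P 1 := by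
        rw [h21]
        abel
      have heq : 2 * (‖P 2 - P 1‖ + ‖P 0 - P 1‖) =
          |(P 2 - P 1) 0 * (P 0 - P 1) 1 - (P 2 - P 1) 1 * (P 0 - P 1) 0| := by
        rw [h21, norm_sub_rev (P 0), add_comm ‖_‖, hP.edge_equation]
        simp only [PiLp.sub_apply]
        ring_nf
      obtain ⟨h2, h0⟩ := signFlip_mem_of_equable ((hP.lattice 2).sub (hP.lattice 1))
        ((hP.lattice 0).sub (hP.lattice 1)) heq (by
          rw [hsum, sub_sub_sub_cancel_right, ← dist_eq_norm, ← dist_eq_norm, dist_comm (P 2),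
            dist_comm (P 3)]
          exact hle)
      rw [hsum] at h2 h0
      refine ⟨P 3 - P 1, 1, fun i => ?_⟩
      fin_cases i
      · exact h0
      · simp [firstQuadrant]
      · exact h2
      · exact signFlip_self_mem _
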